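/- **Setting.** For integers $p,N,k\ge 1$ with $k\le N$ put $E_{\max}=\sqrt{\frac{2p}{k^p}\log\binom Nk}$. Let $A^{(0)},A^{(1)},\dots,A^{(m)}\in(\mathbb R^N)^{\otimes p}$ be random tensors all of whose entries are i.i.d. $\mathcal N(0,1)$, and for $1\le \ell\le m$, $\tau\in[0,\pi/2]$ let $\hat A^{(\ell)}(\tau)=\cos(\tau)A^{(0)}+\sin(\tau)A^{(\ell)}$. For $\gamma>0$, $\frac12<\nu_1<\nu_2<1$ and $\mathcal J\subset[0,\pi/2]$ let $S_\gamma(m,\nu_1,\nu_2,\mathcal J)$ be the set of all $m$-tuples $(\mathcal I_1,\dots,\mathcal I_m)$, $\mathcal I_i=(I_{1,i},\dots,I_{p,i})$, such that (a) $I_{j,i}\subset[N]$ and $|I_{j,i}|=k$ for all $1\le i\le m$, $1\le j\le p$; (b) $\frac{|I_{j,i_1}\cap I_{j,i_2}|}{k}\in[\nu_1,\nu_2]$ for all $1\le i_1<i_2\le m$ and all $1\le j\le p$; (c) there are $\tau_1,\dots,\tau_m\in\mathcal J$ such that for every $1\le \ell\le m$ $$\frac1{k^{p/2}}\sum_{i_1\in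 I_{1,\ell},\dots,i_p\in I_{p,\ell}}\hat A^{(\ell)}_{i_1,\dots,i_p}(\tau_\ell)\ \ge\ \gamma\,k^{p/2}E_{\max}.$$ **Theorem (ensemble $m$-OGP).** There are constants $\theta(p,\gamma,m)>0$, depending only on $p,\gamma,m$, such that the following holds. Let $\alpha\in(0,1)$ (an upper bound on the ratio $k/N$) and $\gamma>0$. There is $P\in\mathbb N$, depending only on $\gamma$ and $\alpha$, such that for every integer $m\ge1$ with $\gamma>1/\sqrt m$ there are $\frac12<\nu_1<\nu_2<1$ and $c>0$, depending only on $\gamma$, $m$ and $\alpha$, for which the following is true. For every $p\ge P$ there are $K_0,N_0$ such that for all $N\ge N_0$ and all $k\ge K_0$ with $k\le\alpha N$, and for every finite set $\mathcal J\subset[0,\pi/2]$ with $|\mathcal J|\le\binom Nk^{c}$, $$\mathbb P\bigl[S_\gamma(m,\nu_1,\nu_2,\mathcal J)=\varnothing\bigr]\ \ge\ 1-\binom Nk^{-\theta(p,\gamma,m)}.$$ -/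

import Mathlib

open MeasureTheory ProbabilityTheory

noncomputable section

namespace Subtensor

/-- The (asymptotic) ground-state value `E_max = √((2p / k^p) log C(N,k))`. -/
def Emax (p N k : ℕ) : ℝ :=
  Real.sqrt (2 * (p : ℝ) / (k : ℝ) ^ p * Real.log (N.choose k : ℝ))

/-- Order-`p` tensors with side length `N`. -/
abbrev Tensor (p N : ℕ) : Type := (Fin p → Fin N) → ℝ

/-- The interpolated tensor `cos τ • A⁽⁰⁾ + sin τ • A⁽ˡ⁾`. The family `A` consists of `A⁽⁰⁾ = A 0`
and `A⁽¹⁾, …, A⁽ᵐ⁾`, the last `m` being indexed by `ℓ.succ` for `ℓ : Fin m`. -/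
def interp {m p N : ℕ} (A : Fin (m + 1) → Tensor p N) (ℓ : Fin m) (τ : ℝ) : Tensor p N :=
  fun x => Real.cos τ * A 0 x + Real.sin τ * A ℓ.succ x

/-- The set `S_γ(m, ν₁, ν₂, J)` of `m`-tuples of near ground states with intermediate overlaps;
`I i j` is the `j`-th index set of the `i`-th `p`-tuple. -/
def overlapSet {m p N : ℕ} (k : ℕ) (γ ν₁ ν₂ : ℝ) (J : Set ℝ) (A : Fin (m + 1) → Tensor p N) :
    Set (Fin m → Fin p → Finset (Fin N)) :=
  {I | (∀ i j, (I i j).card = k) ∧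
    (∀ i₁ i₂, i₁ < i₂ → ∀ j, ((I i₁ j ∩ I i₂ j).card : ℝ) / (k : ℝ) ∈ Set.Icc ν₁ ν₂) ∧
    ∃ τ : Fin m → ℝ, (∀ ℓ, τ ℓ ∈ J) ∧
      ∀ ℓ, 1 / (k : ℝ) ^ ((p : ℝ) / 2) * ∑ x ∈ Fintype.piFinset (I ℓ), interp A ℓ (τ ℓ) x ≥
        γ * (k : ℝ) ^ ((p : ℝ) / 2) * Emax p N k}

/-- All entries of the random tensors `A⁽⁰⁾, …, A⁽ᵐ⁾` are i.i.d. standard Gaussian. -/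
def IsIIDGaussian {Ω : Type*} [MeasurableSpace Ω] (μ : Measure Ω) {m p N : ℕ}
    (A : Fin (m + 1) → (Fin p → Fin N) → Ω → ℝ) : Prop :=
  iIndepFun (fun (q : Fin (m + 1) × (Fin p → Fin N)) => A q.1 q.2) μ ∧
    ∀ ℓ x, HasLaw (A ℓ x) (gaussianReal 0 1) μ

end Subtensor

end

namespace Subtensor

/-! First moment bound. Let `L = log C(N,k)`, and let `n + 1` be the least admissible `m`, so that
`(n+1)γ² = 1 + δ` with `δ > 0`; a larger tuple contains an `(n+1)`-tuple, so this case suffices. Fix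
the sets and angles and add the `n + 1` threshold inequalities. The result is a tail event for one
centred Gaussian of variance at most `k^p (n+1)(1 + n ν₂^p)`: overlaps below 1 become negligible
when raised to the power `p`. Its probability is at most `exp(-p(1+δ)L / (1 + n ν₂^p))`. For each
`j` the first set has `e^L` choices, and each other set lies in an overlap ball of size at most
`e^{εL}`, with `ε → 0` as `ν₁ → 1` (`card_overlapBall_le`). The union bound thus costs about `p(1 +
nε)L`, plus a small term for the angles, and the surplus `δ` wins (`unionBound_exponent_le`). -/

/-! ### Counting sets with large overlap -/

/-- Chernoff counting: weight each `S` by `x^(|S| - d)`, which is at least 1 on the sets counted,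
and sum over all subsets. -/
theorem card_powerset_filter_card_le {ι : Type*} [DecidableEq ι] (T : Finset ι) (d : ℝ) {x : ℝ}
    (hx : 0 < x) (hx1 : x ≤ 1) :
    ((T.powerset.filter fun S => (S.card : ℝ) ≤ d).card : ℝ) ≤
      x ^ (-d) * Real.exp (x * T.card) := by
  have h1 : ∀ S ∈ T.powerset.filter (fun S => (S.card : ℝ) ≤ d),
      (1 : ℝ) ≤ x ^ (-d) * x ^ S.card := by
    intro S hS
    rw [← Real.rpow_natCast x, ← Real.rpow_add hx]
    apply Real.one_le_rpow_of_pos_of_le_one_of_nonpos hx hx1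
    have := (Finset.mem_filter.1 hS).2
    linarith
  calc ((T.powerset.filter fun S => (S.card : ℝ) ≤ d).card : ℝ)
      = ∑ S ∈ T.powerset.filter (fun S => (S.card : ℝ) ≤ d), (1 : ℝ) := by simp
    _ ≤ ∑ S ∈ T.powerset.filter (fun S => (S.card : ℝ) ≤ d), x ^ (-d) * x ^ S.card :=
        Finset.sum_le_sum h1
    _ ≤ ∑ S ∈ T.powerset, x ^ (-d) * x ^ S.card :=
        Finset.sum_le_sum_of_subset_of_nonneg (Finset.filter_subset _ _)
          fun _ _ _ => by positivity
    _ = x ^ (-d) * (x + 1) ^ T.card := by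
        rw [← Finset.mul_sum, ← Finset.sum_pow_mul_eq_add_pow]
        simp
    _ ≤ x ^ (-d) * Real.exp (x * T.card) := by
        gcongr
        rw [mul_comm, Real.exp_nat_mul]
        gcongr
        exact Real.add_one_le_exp x

theorem div_pow_le_choose {n k : ℕ} (h : k ≤ n) : ((n : ℝ) / k) ^ k ≤ n.choose k := by
  induction k generalizing n with
  | zero => simp
  | succ k ih =>
    obtain ⟨n, rfl⟩ : ∃ l, n = l + 1 := ⟨n - 1, by omega⟩
    have hkn : k ≤ n := by omega
    have h1 : ((n + 1 : ℕ) : ℝ) * n.choose k = (n + 1).choose (k + 1) * ((k + 1 : ℕ) : ℝ) :=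
      mod_cast Nat.add_one_mul_choose_eq n k
    have h2 : (((n + 1 : ℕ) : ℝ) / (k + 1 : ℕ)) ^ k ≤ ((n : ℝ) / k) ^ k := by
      rcases Nat.eq_zero_or_pos k with rfl | hk
      · simp
      · refine pow_le_pow_left₀ (by positivity) ?_ k
        rw [div_le_div_iff₀ (by positivity) (by positivity)]
        have : (k : ℝ) ≤ n := mod_cast hkn
        push_cast
        nlinarith
    have h3 : ((n + 1).choose (k + 1) : ℝ) = ((n + 1 : ℕ) : ℝ) / (k + 1 : ℕ) * n.choose k := by
      rw [div_mul_eq_mul_div, h1]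
      field_simp
    rw [pow_succ', h3]
    gcongr
    exact h2.trans (ih hkn)

theorem mul_log_div_le_log_choose {n k : ℕ} (hk : 1 ≤ k) (h : k ≤ n) :
    k * Real.log ((n : ℝ) / k) ≤ Real.log (n.choose k) := by
  rw [← Real.log_pow]
  have : (0 : ℝ) < n := mod_cast by omega
  have : (0 : ℝ) < k := mod_cast by omega
  exact Real.log_le_log (by positivity) (div_pow_le_choose h)

/-- The sets of the same size as `I` which overlap with `I` in at least a proportion `ν`. -/
noncomputable def overlapBall {N : ℕ} (ν : ℝ) (I : Finset (Fin N)) : Finset (Finset (Fin N)) :=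
  Finset.univ.filter fun J => J.card = I.card ∧ ν * I.card ≤ ((I ∩ J).card : ℝ)

/-- `J` is recovered from the pair `(I \ J, J \ I)`, and both differences have at most `η|I|`
elements. -/
theorem card_overlapBall_le_mul {N : ℕ} (η : ℝ) (I : Finset (Fin N)) :
    (overlapBall (1 - η) I).card ≤
      (I.powerset.filter fun S => (S.card : ℝ) ≤ η * I.card).card *
        ((Finset.univ : Finset (Fin N)).powerset.filter fun S => (S.card : ℝ) ≤ η * I.card).card
        := by
  rw [← Finset.card_product]
  refine Finset.card_le_card_of_injOn (fun J => (I \ J, J \ I)) ?_ ?_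
  · intro J hJ
    simp only [overlapBall, Finset.coe_filter, Finset.mem_univ, true_and, Set.mem_ofPred_eq] at hJ
    obtain ⟨h1, h2⟩ := hJ
    have h3 : ((I \ J).card : ℝ) + (I ∩ J).card = I.card :=
      mod_cast Finset.card_sdiff_add_card_inter I J
    have h4 : ((J \ I).card : ℝ) + (I ∩ J).card = I.card := by
      rw [Finset.inter_comm, ← h1]
      exact mod_cast Finset.card_sdiff_add_card_inter J I
    simp only [Finset.coe_product, Finset.coe_filter, Finset.mem_powerset, Set.mem_prod,
      Set.mem_ofPred_eq, Finset.sdiff_subset, true_and, Finset.subset_univ]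
    constructor <;> linarith
  · intro J _ J' _ h
    simp only [Prod.mk.injEq] at h
    ext x
    have h1 := congrArg (fun S => x ∈ S) h.1
    have h2 := congrArg (fun S => x ∈ S) h.2
    simp only [Finset.mem_sdiff, eq_iff_iff] at h1 h2
    tauto

/-- The exponent in the bound for the size of an overlap ball. -/
noncomputable def ballExponent (α η : ℝ) : ℝ := η * (1 + (2 - 2 * Real.log η) / (-Real.log α))

theorem card_overlapBall_le {N k : ℕ} {α η : ℝ} (hα : 0 < α) (hα1 : α < 1) (hη : 0 < η)
    (hη1 : η ≤ 1) (hk : 1 ≤ k) (hkN : (k : ℝ) ≤ α * N) {I : Finset (Fin N)} (hI : I.card = k) :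
    ((overlapBall (1 - η) I).card : ℝ) ≤
      Real.exp (ballExponent α η * Real.log (N.choose k)) := by
  have hk0 : (0 : ℝ) < k := mod_cast hk
  have hN0 : (0 : ℝ) < N := by
    by_contra! h
    nlinarith
  have hle : (k : ℝ) ≤ N := by nlinarith
  have hle' : k ≤ N := mod_cast hle
  -- The weights `η` on `I` and `ηk/N` on `[N]` both make `x|T|` equal to `ηk`.
  have h1 := card_powerset_filter_card_le I (η * k) hη hη1
  have hx : 0 < η * k / N := by positivity
  have hx1 : η * k / N ≤ 1 := by
    rw [div_le_one hN0]
    nlinarith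
  have h2 := card_powerset_filter_card_le (Finset.univ : Finset (Fin N)) (η * k) hx hx1
  have h0 := card_overlapBall_le_mul η I
  rw [hI] at h0 h1
  have h3 := mul_log_div_le_log_choose hk hle'
  have hlogα : 0 < -Real.log α := by
    have := Real.log_neg hα hα1
    linarith
  have h4 : -Real.log α ≤ Real.log ((N : ℝ) / k) := by
    rw [← Real.log_inv]
    apply Real.log_le_log (by positivity)
    rw [inv_eq_one_div, div_le_div_iff₀ hα hk0]
    linarith
  have hlogη : Real.log η ≤ 0 := Real.log_nonpos hη.le hη1
  calc ((overlapBall (1 - η) I).card : ℝ)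
      ≤ (η ^ (-(η * k)) * Real.exp (η * k)) *
          ((η * k / N) ^ (-(η * k)) * Real.exp (η * k / N * N)) := by
        refine (Nat.cast_le.2 h0).trans ?_
        rw [Nat.cast_mul]
        refine mul_le_mul h1 ?_ (by positivity) (by positivity)
        simpa using h2
    _ = Real.exp (η * (k * (2 - 2 * Real.log η) + k * Real.log ((N : ℝ) / k))) := by
        rw [Real.rpow_def_of_pos hη, Real.rpow_def_of_pos hx, ← Real.exp_add, ← Real.exp_add,
          ← Real.exp_add]
        congr 1
        rw [Real.log_div (by positivity) hN0.ne', Real.log_mul hη.ne' hk0.ne',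
          Real.log_div hN0.ne' hk0.ne']
        field_simp
        ring
    _ ≤ Real.exp (ballExponent α η * Real.log (N.choose k)) := by
        apply Real.exp_le_exp.2
        rw [ballExponent, mul_assoc]
        apply mul_le_mul_of_nonneg_left _ hη.le
        -- Since `k ≤ αN`, `log C(N,k)` is at least `k(-log α)` and absorbs terms linear in `k`.
        have h5 : k * (2 - 2 * Real.log η) ≤
            (2 - 2 * Real.log η) / (-Real.log α) * Real.log (N.choose k) := by
          rw [div_mul_eq_mul_div, le_div_iff₀ hlogα]
          have : k * (-Real.log α) ≤ Real.log (N.choose k) :=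
            (mul_le_mul_of_nonneg_left h4 hk0.le).trans h3
          nlinarith
        linarith

/-- `η log η → 0` as `η → 0`. -/
theorem exists_mul_ballExponent_le (α K : ℝ) {ρ : ℝ} (hρ : 0 < ρ) :
    ∃ η : ℝ, 0 < η ∧ η < 1 / 2 ∧ K * ballExponent α η ≤ ρ := by
  have h1 : Filter.Tendsto (fun η : ℝ => K * ballExponent α η) (nhds 0) (nhds 0) := by
    have h2 : Continuous fun η : ℝ => K * ballExponent α η := by
      have h3 : (fun η : ℝ => K * ballExponent α η) = fun η =>
          K * (η + (2 * η - 2 * (η * Real.log η)) / (-Real.log α)) := by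
        funext η
        unfold ballExponent
        ring
      rw [h3]
      have := Real.continuous_mul_log
      fun_prop
    simpa [ballExponent] using h2.tendsto 0
  have h2 := (h1.mono_left (nhdsWithin_le_nhds (s := Set.Ioi 0))).eventually (gt_mem_nhds hρ)
  have h3 : ∀ᶠ η : ℝ in nhdsWithin 0 (Set.Ioi 0), η ∈ Set.Ioo (0 : ℝ) (1 / 2) :=
    Ioo_mem_nhdsGT (by norm_num)
  obtain ⟨η, h4, h5⟩ := (h2.and h3).exists
  exact ⟨η, h5.1, h5.2, h4.le⟩

/-- The `m`-tuples of `k`-sets with pairwise overlaps in the interval `[ν₁ k, ν₂ k]`. -/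
noncomputable def overlapTuples (m N k : ℕ) (ν₁ ν₂ : ℝ) : Finset (Fin m → Finset (Fin N)) :=
  Finset.univ.filter fun f => (∀ i, (f i).card = k) ∧
    ∀ i₁ i₂, i₁ < i₂ → ((f i₁ ∩ f i₂).card : ℝ) / k ∈ Set.Icc ν₁ ν₂

theorem card_overlapTuples_le {n N k : ℕ} (hk : 1 ≤ k) {ν₁ ν₂ B : ℝ}
    (hB : ∀ I : Finset (Fin N), I.card = k → ((overlapBall ν₁ I).card : ℝ) ≤ B) :
    ((overlapTuples (n + 1) N k ν₁ ν₂).card : ℝ) ≤ N.choose k * B ^ n := by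
  classical
  have hk0 : (0 : ℝ) < k := mod_cast hk
  let G := (Finset.powersetCard k (Finset.univ : Finset (Fin N))).sigma
    fun I => Fintype.piFinset fun _ : Fin n => overlapBall ν₁ I
  have h1 : (overlapTuples (n + 1) N k ν₁ ν₂).card ≤ G.card := by
    refine Finset.card_le_card_of_injOn (fun f => ⟨f 0, fun i => f i.succ⟩) ?_ ?_
    · intro f hf
      simp only [overlapTuples, Finset.coe_filter, Finset.mem_univ, true_and,
        Set.mem_ofPred_eq] at hf
      simp only [G, Finset.mem_coe, Finset.mem_sigma, Finset.mem_powersetCard,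
        Finset.subset_univ, true_and, Fintype.mem_piFinset, overlapBall, Finset.mem_filter,
        Finset.mem_univ]
      refine ⟨hf.1 0, fun i => ⟨by rw [hf.1, hf.1], ?_⟩⟩
      have := (hf.2 0 i.succ (Fin.succ_pos i)).1
      rw [hf.1]
      rwa [le_div_iff₀ hk0] at this
    · intro f _ g _ h
      simp only [Sigma.mk.injEq, heq_eq_eq] at h
      funext i
      refine Fin.cases h.1 (fun i => congrFun h.2 i) i
  calc ((overlapTuples (n + 1) N k ν₁ ν₂).card : ℝ) ≤ G.card := mod_cast h1
    _ = ∑ I ∈ Finset.powersetCard k (Finset.univ : Finset (Fin N)),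
          ((overlapBall ν₁ I).card : ℝ) ^ n := by
        simp [G, Finset.card_sigma]
    _ ≤ ∑ I ∈ Finset.powersetCard k (Finset.univ : Finset (Fin N)), B ^ n := by
        refine Finset.sum_le_sum fun I hI => ?_
        gcongr
        exact hB I (Finset.mem_powersetCard.1 hI).2
    _ = N.choose k * B ^ n := by simp

/-! ### Variance and tails of the summed Gaussians -/

/-- Coefficients expressing a sum of sums of interpolated entries in terms of the entries. -/
noncomputable def interpWeight {M : ℕ} {X : Type*} [DecidableEq X] (a b : Fin M → ℝ) (S : Fin M → Finset X) :
    Fin (M + 1) × X → ℝ :=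
  fun q => Fin.cases (motive := fun _ => ℝ) (∑ ℓ, if q.2 ∈ S ℓ then a ℓ else 0)
    (fun ℓ => if q.2 ∈ S ℓ then b ℓ else 0) q.1

theorem sum_interpWeight_mul {M : ℕ} {X : Type*} [Fintype X] [DecidableEq X] (a b : Fin M → ℝ)
    (S : Fin M → Finset X) (f : Fin (M + 1) → X → ℝ) :
    ∑ q, interpWeight a b S q * f q.1 q.2 =
      ∑ ℓ, ∑ x ∈ S ℓ, (a ℓ * f 0 x + b ℓ * f ℓ.succ x) := by
  rw [Fintype.sum_prod_type, Fin.sum_univ_succ]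
  simp only [interpWeight, Fin.cases_zero, Fin.cases_succ, Finset.sum_mul,
    Finset.sum_add_distrib, ite_mul, zero_mul]
  rw [Finset.sum_comm]
  simp [Finset.sum_ite_mem]

theorem sum_interpWeight_sq {M : ℕ} {X : Type*} [Fintype X] [DecidableEq X] (a b : Fin M → ℝ)
    (S : Fin M → Finset X) :
    ∑ q, interpWeight a b S q ^ 2 =
      (∑ ℓ, ∑ ℓ', a ℓ * a ℓ' * ((S ℓ ∩ S ℓ').card : ℝ)) + ∑ ℓ, b ℓ ^ 2 * ((S ℓ).card : ℝ) := by
  rw [Fintype.sum_prod_type, Fin.sum_univ_succ]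
  congr 1
  · simp only [interpWeight, Fin.cases_zero, sq, Finset.sum_mul_sum]
    rw [Finset.sum_comm]
    refine Finset.sum_congr rfl fun ℓ _ => ?_
    rw [Finset.sum_comm]
    refine Finset.sum_congr rfl fun ℓ' _ => ?_
    simp only [ite_mul, mul_ite, mul_zero, zero_mul, ← ite_and, ← Finset.mem_inter]
    rw [Finset.sum_ite_mem]
    simp [mul_comm, Finset.inter_comm]
  · simp only [interpWeight, Fin.cases_succ, ite_pow]
    refine Finset.sum_congr rfl fun ℓ _ => ?_
    simp [Finset.sum_ite_mem, mul_comm]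

/-- Only the shared tensor correlates different `ℓ`, through `|S ℓ ∩ S ℓ'|`; on the diagonal `a² +
b² = 1` leaves `n`. -/
theorem sum_interpWeight_sq_le {M : ℕ} {X : Type*} [Fintype X] [DecidableEq X]
    {a b : Fin M → ℝ} (hab : ∀ ℓ, a ℓ ^ 2 + b ℓ ^ 2 = 1) {S : Fin M → Finset X} {n r : ℝ}
    (hn : ∀ ℓ, ((S ℓ).card : ℝ) = n) (hr : ∀ ℓ ℓ', ℓ ≠ ℓ' → ((S ℓ ∩ S ℓ').card : ℝ) ≤ r * n) :
    ∑ q, interpWeight a b S q ^ 2 ≤ n * (M * (1 + (M - 1) * r)) := by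
  have ha : ∀ ℓ, |a ℓ| ≤ 1 := fun ℓ =>
    abs_le_one_iff_mul_self_le_one.2 (by nlinarith [hab ℓ, sq_nonneg (b ℓ)])
  have h1 : ∀ ℓ ℓ', a ℓ * a ℓ' * ((S ℓ ∩ S ℓ').card : ℝ) ≤
      r * n + if ℓ = ℓ' then a ℓ ^ 2 * n - r * n else 0 := by
    intro ℓ ℓ'
    split_ifs with h
    · subst h
      rw [Finset.inter_self, hn]
      exact le_of_eq (by ring)
    · have h2 : a ℓ * a ℓ' ≤ 1 := by
        refine (le_abs_self _).trans ?_
        rw [abs_mul]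
        exact mul_le_one₀ (ha ℓ) (abs_nonneg _) (ha ℓ')
      calc a ℓ * a ℓ' * ((S ℓ ∩ S ℓ').card : ℝ) ≤ 1 * ((S ℓ ∩ S ℓ').card : ℝ) := by gcongr
        _ ≤ r * n + 0 := by simpa using hr ℓ ℓ' h
  rw [sum_interpWeight_sq, ← Finset.sum_add_distrib]
  calc ∑ ℓ, (∑ ℓ', a ℓ * a ℓ' * ((S ℓ ∩ S ℓ').card : ℝ) + b ℓ ^ 2 * ((S ℓ).card : ℝ))
      ≤ ∑ ℓ : Fin M, (n * (1 + (M - 1) * r)) := by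
        refine Finset.sum_le_sum fun ℓ _ => ?_
        rw [hn]
        have h2 := Finset.sum_le_sum fun ℓ' (_ : ℓ' ∈ Finset.univ) => h1 ℓ ℓ'
        rw [Finset.sum_add_distrib] at h2
        simp only [Finset.sum_const, Finset.card_univ, Fintype.card_fin, nsmul_eq_mul,
          Finset.sum_ite_eq, Finset.mem_univ, if_true] at h2
        have h3 : b ℓ ^ 2 = 1 - a ℓ ^ 2 := by linarith [hab ℓ]
        rw [h3]
        linarith
    _ = n * (M * (1 + (M - 1) * r)) := by
        simp
        ring

theorem hasSubgaussianMGF_of_hasLaw_gaussianReal {Ω : Type*} [MeasurableSpace Ω] {μ : Measure Ω}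
    {X : Ω → ℝ} (hX : HasLaw X (gaussianReal 0 1) μ) : HasSubgaussianMGF X 1 μ := by
  rw [← HasSubgaussianMGF.id_map_iff hX.aemeasurable, hX.map_eq]
  refine ⟨fun t => ?_, fun t => ?_⟩
  · simpa using integrable_exp_mul_gaussianReal t
  · rw [mgf_id_gaussianReal]
    simp

theorem measureReal_sum_mul_ge_le {Ω ι : Type*} [Fintype ι] [MeasurableSpace Ω] {μ : Measure Ω}
    [IsProbabilityMeasure μ] {X : ι → Ω → ℝ} (hX : iIndepFun X μ)
    (hlaw : ∀ i, HasLaw (X i) (gaussianReal 0 1) μ) (w : ι → ℝ) {s V : ℝ} (hs : 0 ≤ s)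
    (hV : ∑ i, w i ^ 2 ≤ V) :
    μ.real {ω | s ≤ ∑ i, w i * X i ω} ≤ Real.exp (-s ^ 2 / (2 * V)) := by
  have hV0 : 0 ≤ V := (Finset.sum_nonneg fun i _ => sq_nonneg (w i)).trans hV
  have h1 : HasSubgaussianMGF (fun ω => ∑ i, w i * X i ω)
      (∑ i, NNReal.mk (w i ^ 2) (sq_nonneg _) * 1) μ :=
    HasSubgaussianMGF.sum_of_iIndepFun
      (hX.comp (fun i x => w i * x) fun i => by fun_prop)
      fun i _ => (hasSubgaussianMGF_of_hasLaw_gaussianReal (hlaw i)).const_mul (w i)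
  have h2 : HasSubgaussianMGF (fun ω => ∑ i, w i * X i ω) (NNReal.mk V hV0) μ := by
    refine ⟨h1.1, fun t => (h1.2 t).trans ?_⟩
    apply Real.exp_le_exp.2
    gcongr
    rw [← NNReal.coe_le_coe, NNReal.coe_sum]
    simpa using hV
  exact h2.measure_ge_le hs

/-! ### Union bound over sets and angles -/

theorem measureReal_overlapSet_nonempty_le {n p N k : ℕ} (hk : 1 ≤ k) {γ ν₁ ν₂ B : ℝ}
    (hγ : 0 < γ) (hν₂ : 0 ≤ ν₂)
    (hB : ∀ I : Finset (Fin N), I.card = k → ((overlapBall ν₁ I).card : ℝ) ≤ B)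
    (J : Finset ℝ) {Ω : Type*} [MeasurableSpace Ω] (μ : Measure Ω) [IsProbabilityMeasure μ]
    {A : Fin (n + 1 + 1) → (Fin p → Fin N) → Ω → ℝ} (hA : IsIIDGaussian μ A) :
    μ.real {ω | (overlapSet k γ ν₁ ν₂ (J : Set ℝ) (fun ℓ x => A ℓ x ω)).Nonempty} ≤
      (J.card : ℝ) ^ (n + 1) * ((N.choose k * B ^ n) ^ p *
        Real.exp (-((n + 1) * γ ^ 2 * p * Real.log (N.choose k) / (1 + n * ν₂ ^ p)))) := by
  have hk0 : (0 : ℝ) < k := mod_cast hk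
  set s : ℝ := (n + 1) * (γ * k ^ p * Emax p N k) with hs
  have hE : 0 ≤ Emax p N k := Real.sqrt_nonneg _
  have hs0 : 0 ≤ s := by positivity
  have hE2 : Emax p N k ^ 2 = 2 * (p : ℝ) / (k : ℝ) ^ p * Real.log (N.choose k : ℝ) := by
    refine Real.sq_sqrt ?_
    have := Real.log_natCast_nonneg (N.choose k)
    positivity
  let F : Finset (Fin p → Fin (n + 1) → Finset (Fin N)) :=
    Fintype.piFinset fun _ => overlapTuples (n + 1) N k ν₁ ν₂
  let T : Finset (Fin (n + 1) → ℝ) := Fintype.piFinset fun _ => J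
  let w (τ : Fin (n + 1) → ℝ) (I : Fin p → Fin (n + 1) → Finset (Fin N)) :=
    interpWeight (fun ℓ => Real.cos (τ ℓ)) (fun ℓ => Real.sin (τ ℓ))
      fun ℓ => Fintype.piFinset fun j => I j ℓ
  have hsub : {ω | (overlapSet k γ ν₁ ν₂ (J : Set ℝ) (fun ℓ x => A ℓ x ω)).Nonempty} ⊆
      ⋃ τ ∈ T, ⋃ I ∈ F, {ω | s ≤ ∑ q, w τ I q * A q.1 q.2 ω} := by
    rintro ω ⟨I, hcard, hov, τ, hτ, hI⟩
    simp only [Set.mem_iUnion]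
    refine ⟨τ, Fintype.mem_piFinset.2 hτ, fun j ℓ => I ℓ j,
      Fintype.mem_piFinset.2 fun j => ?_, ?_⟩
    · simp only [overlapTuples, Finset.mem_filter, Finset.mem_univ, true_and]
      exact ⟨fun i => hcard i j, fun i₁ i₂ h => hov i₁ i₂ h j⟩
    · change s ≤ _
      rw [sum_interpWeight_mul _ _ _ fun ℓ x => A ℓ x ω]
      have h1 : ∀ ℓ ∈ (Finset.univ : Finset (Fin (n + 1))), γ * k ^ p * Emax p N k ≤
          ∑ x ∈ Fintype.piFinset (I ℓ), interp (fun ℓ x => A ℓ x ω) ℓ (τ ℓ) x := by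
        intro ℓ _
        have h2 := hI ℓ
        have h3 : (0 : ℝ) < (k : ℝ) ^ ((p : ℝ) / 2) := by positivity
        have h4 : (k : ℝ) ^ ((p : ℝ) / 2) * (k : ℝ) ^ ((p : ℝ) / 2) = k ^ p := by
          rw [← Real.rpow_add hk0, add_halves, Real.rpow_natCast]
        rw [ge_iff_le, one_div_mul_eq_div, le_div_iff₀ h3] at h2
        rw [← h4]
        linarith
      have h5 := Finset.sum_le_sum h1
      simpa [hs, interp] using h5
  have hV : ∀ τ, ∀ I ∈ F, ∑ q, w τ I q ^ 2 ≤ k ^ p * ((n + 1) * (1 + n * ν₂ ^ p)) := by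
    intro τ I hI
    have hI' : ∀ j, (∀ i, (I j i).card = k) ∧
        ∀ i₁ i₂, i₁ < i₂ → ((I j i₁ ∩ I j i₂).card : ℝ) / k ∈ Set.Icc ν₁ ν₂ := by
      intro j
      simpa [overlapTuples] using Fintype.mem_piFinset.1 hI j
    have hle : ∀ j i₁ i₂, i₁ ≠ i₂ → ((I j i₁ ∩ I j i₂).card : ℝ) ≤ ν₂ * k := by
      intro j i₁ i₂ hne
      rw [← div_le_iff₀ hk0]
      rcases lt_or_gt_of_ne hne with h | h
      · exact ((hI' j).2 _ _ h).2
      · rw [Finset.inter_comm]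
        exact ((hI' j).2 _ _ h).2
    have h := sum_interpWeight_sq_le (a := fun ℓ => Real.cos (τ ℓ))
      (b := fun ℓ => Real.sin (τ ℓ)) (S := fun ℓ => Fintype.piFinset fun j => I j ℓ)
      (n := k ^ p) (r := ν₂ ^ p) (fun ℓ => Real.cos_sq_add_sin_sq _)
      (fun ℓ => by simp [Fintype.card_piFinset, (hI' _).1]) ?_
    · simpa using h
    · intro ℓ ℓ' hne
      rw [← Fintype.piFinset_inter, Fintype.card_piFinset, Nat.cast_prod, ← mul_pow]
      refine (Finset.prod_le_prod (fun _ _ => Nat.cast_nonneg _)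
        fun j _ => hle j ℓ ℓ' hne).trans ?_
      simp
  have hone : ∀ τ, ∀ I ∈ F, μ.real {ω | s ≤ ∑ q, w τ I q * A q.1 q.2 ω} ≤
      Real.exp (-((n + 1) * γ ^ 2 * p * Real.log (N.choose k) / (1 + n * ν₂ ^ p))) := by
    intro τ I hI
    refine (measureReal_sum_mul_ge_le hA.1 (fun q => hA.2 q.1 q.2) (w τ I) hs0
      (hV τ I hI)).trans (le_of_eq ?_)
    congr 1
    have : (0 : ℝ) < 1 + n * ν₂ ^ p := by positivity
    rw [hs, mul_pow, mul_pow, hE2]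
    field_simp
  have hF : (F.card : ℝ) ≤ (N.choose k * B ^ n) ^ p := by
    rw [Fintype.card_piFinset_const, Nat.cast_pow]
    gcongr
    exact card_overlapTuples_le hk hB
  have hT : (T.card : ℝ) = (J.card : ℝ) ^ (n + 1) := by
    rw [Fintype.card_piFinset_const, Nat.cast_pow]
  refine (measureReal_mono hsub (measure_ne_top μ _)).trans ?_
  refine (measureReal_biUnion_finset_le T _).trans ?_
  rw [← hT, ← nsmul_eq_mul]
  refine Finset.sum_le_card_nsmul T _ _ fun τ _ => ?_
  refine (measureReal_biUnion_finset_le F _).trans ?_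
  refine (Finset.sum_le_card_nsmul F _ _ (hone τ)).trans ?_
  rw [nsmul_eq_mul]
  gcongr

/-! ### Reduction to fewer replicas and choice of constants -/

theorem overlapSet_nonempty_castLE {M m p N k : ℕ} (h : M ≤ m) {γ ν₁ ν₂ : ℝ} {J : Set ℝ}
    {A : Fin (m + 1) → Tensor p N} (hS : (overlapSet k γ ν₁ ν₂ J A).Nonempty) :
    (overlapSet k γ ν₁ ν₂ J
      fun i : Fin (M + 1) => A (Fin.castLE (Nat.succ_le_succ h) i)).Nonempty := by
  obtain ⟨I, hcard, hov, τ, hτ, hI⟩ := hS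
  exact ⟨fun i => I (Fin.castLE h i), fun i j => hcard _ j, fun i₁ i₂ hlt j => hov _ _ hlt j,
    fun i => τ (Fin.castLE h i), fun i => hτ _, fun i => hI (Fin.castLE h i)⟩

theorem IsIIDGaussian.castLE {M m p N : ℕ} (h : M ≤ m) {Ω : Type*} [MeasurableSpace Ω]
    {μ : Measure Ω} {A : Fin (m + 1) → (Fin p → Fin N) → Ω → ℝ} (hA : IsIIDGaussian μ A) :
    IsIIDGaussian μ fun i : Fin (M + 1) => A (Fin.castLE (Nat.succ_le_succ h) i) := by
  refine ⟨hA.1.precomp (g := Prod.map (Fin.castLE (Nat.succ_le_succ h)) id) ?_,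
    fun ℓ x => hA.2 _ x⟩
  exact (Fin.castLE_injective _).prodMap Function.injective_id

/-- Budget: the angles cost `δ/4`, the overlap balls `pδ/4`, and the correlations lower `p(1+δ)` by
at most `pδ/4`. What remains is `δ/4 - pδ/2`, at most `-δ/4` because `p ≥ 1`. -/
theorem unionBound_exponent_le {n p : ℕ} (hp : 1 ≤ p) {γ δ ε r c : ℝ} (hδ : 0 < δ)
    (hγ : (n + 1) * γ ^ 2 = 1 + δ) (hε : n * ε ≤ δ / 4) (hr0 : 0 ≤ n * r)
    (hr : n * r ≤ δ / (4 * (1 + δ))) (hc : c = δ / (4 * (n + 1))) :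
    c * (n + 1) + p * (1 + n * ε) - (n + 1) * γ ^ 2 * p / (1 + n * r) ≤ -(δ / 4) := by
  have hp1 : (1 : ℝ) ≤ p := mod_cast hp
  have h1 : c * (n + 1) = δ / 4 := by
    rw [hc]
    field_simp
  have h2 : (1 + 3 * δ / 4) * p ≤ (n + 1) * γ ^ 2 * p / (1 + n * r) := by
    rw [hγ, le_div_iff₀ (by linarith)]
    rw [le_div_iff₀ (by linarith)] at hr
    have h3 : (1 + 3 * δ / 4) * (1 + n * r) ≤ 1 + δ := by nlinarith
    nlinarith
  have h4 : p * (n * ε) ≤ p * (δ / 4) := by gcongr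
  nlinarith

end Subtensor

open Subtensor in
theorem theorem5p2 :
    ∃ θ : ℕ → ℝ → ℕ → ℝ, (∀ p γ m, 0 < θ p γ m) ∧
    ∀ α : ℝ, 0 < α → α < 1 → ∀ γ : ℝ, 0 < γ →
    ∃ P : ℕ, ∀ m : ℕ, 1 ≤ m → γ > 1 / Real.sqrt (m : ℝ) →
    ∃ ν₁ ν₂ c : ℝ, 1 / 2 < ν₁ ∧ ν₁ < ν₂ ∧ ν₂ < 1 ∧ 0 < c ∧
    ∀ p : ℕ, P ≤ p →
    ∃ K₀ N₀ : ℕ, ∀ N k : ℕ, N₀ ≤ N → K₀ ≤ k → (k : ℝ) ≤ α * (N : ℝ) →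
    ∀ J : Finset ℝ, (J : Set ℝ) ⊆ Set.Icc 0 (Real.pi / 2) →
      (J.card : ℝ) ≤ (N.choose k : ℝ) ^ c →
    ∀ {Ω : Type*} [MeasurableSpace Ω] (μ : Measure Ω) [IsProbabilityMeasure μ]
      (A : Fin (m + 1) → (Fin p → Fin N) → Ω → ℝ), Subtensor.IsIIDGaussian μ A →
      μ.real {ω | Subtensor.overlapSet k γ ν₁ ν₂ (J : Set ℝ) (fun ℓ x => A ℓ x ω) = ∅} ≥
        1 - (N.choose k : ℝ) ^ (-θ p γ m) := by
  have hgap : ∀ γ : ℝ, 0 < γ → 0 < ((⌊1 / γ ^ 2⌋₊ : ℝ) + 1) * γ ^ 2 - 1 := by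
    intro γ hγ
    have := Nat.lt_floor_add_one (1 / γ ^ 2)
    rw [div_lt_iff₀ (by positivity)] at this
    linarith
  -- A quarter of the gap `δ`; the value 1 only keeps `θ` positive for `γ ≤ 0`.
  refine ⟨fun _ γ _ => if 0 < γ then (((⌊1 / γ ^ 2⌋₊ : ℝ) + 1) * γ ^ 2 - 1) / 4 else 1,
    fun p γ m => ?_, ?_⟩
  · dsimp only
    split_ifs with h
    · have := hgap γ h
      positivity
    · exact one_pos
  intro α hα hα1 γ hγ
  -- It suffices to treat the least admissible `m`, which is `n + 1`.
  set n := ⌊1 / γ ^ 2⌋₊ with hn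
  set δ : ℝ := ((n : ℝ) + 1) * γ ^ 2 - 1 with hδdef
  have hδ : 0 < δ := hgap γ hγ
  obtain ⟨η, hη, hη2, hηε⟩ := exists_mul_ballExponent_le α n (by positivity : 0 < δ / 4)
  -- Any value strictly between `ν₁ = 1 - η` and 1 would do.
  set ν₂ : ℝ := 1 - η / 2 with hν₂
  have hν₂0 : 0 ≤ ν₂ := by linarith
  have hν₂1 : ν₂ < 1 := by linarith
  obtain ⟨P, hP⟩ : ∃ P : ℕ, ∀ p, P ≤ p → n * ν₂ ^ p ≤ δ / (4 * (1 + δ)) := by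
    have h1 : Filter.Tendsto (fun p : ℕ => (n : ℝ) * ν₂ ^ p) Filter.atTop (nhds 0) := by
      simpa using (tendsto_pow_atTop_nhds_zero_of_lt_one hν₂0 hν₂1).const_mul (n : ℝ)
    have h2 : 0 < δ / (4 * (1 + δ)) := by positivity
    exact Filter.eventually_atTop.1 ((h1.eventually (gt_mem_nhds h2)).mono fun _ h => h.le)
  refine ⟨max P 1, fun m hm hγm => ?_⟩
  have hnm : n + 1 ≤ m := by
    have hm0 : (0 : ℝ) < m := mod_cast hm
    rw [Nat.add_one_le_iff, hn, Nat.floor_lt (by positivity), div_lt_iff₀ (by positivity)]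
    rw [gt_iff_lt, div_lt_iff₀ (Real.sqrt_pos.2 hm0)] at hγm
    have h1 : (1 : ℝ) < (γ * Real.sqrt m) ^ 2 := by nlinarith
    rw [mul_pow, Real.sq_sqrt hm0.le] at h1
    linarith
  -- The bound is non-asymptotic: `K₀ = 1` only ensures `k ≥ 1`.
  refine ⟨1 - η, ν₂, δ / (4 * (n + 1)), by linarith, by linarith, hν₂1, by positivity,
    fun p hp => ⟨1, 0, ?_⟩⟩
  intro N k _ hk hkN J _ hJ Ω _ μ _ A hA
  beta_reduce
  rw [if_pos hγ]
  have hp1 : 1 ≤ p := (le_max_right _ _).trans hp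
  have hkN' : k ≤ N := by
    have : (0 : ℝ) ≤ N := Nat.cast_nonneg N
    have : (k : ℝ) ≤ N := by nlinarith
    exact mod_cast this
  have hC : (0 : ℝ) < N.choose k := mod_cast Nat.choose_pos hkN'
  have hL : 0 ≤ Real.log (N.choose k) := Real.log_natCast_nonneg _
  have hbound := measureReal_overlapSet_nonempty_le (ν₁ := 1 - η) hk hγ hν₂0
    (fun I hI => card_overlapBall_le hα hα1 hη (by linarith) hk hkN hI) J μ (hA.castLE hnm)
  have hfail : μ.real {ω | overlapSet k γ (1 - η) ν₂ (J : Set ℝ) (fun ℓ x => A ℓ x ω) = ∅}ᶜ ≤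
      (N.choose k : ℝ) ^ (-(δ / 4)) := by
    refine (measureReal_mono fun ω hω => overlapSet_nonempty_castLE hnm
      (Set.nonempty_iff_ne_empty.2 hω)).trans (hbound.trans ?_)
    rw [Real.rpow_def_of_pos hC] at hJ ⊢
    calc _ ≤ Real.exp (Real.log (N.choose k) * (δ / (4 * (n + 1)))) ^ (n + 1) *
          ((Real.exp (Real.log (N.choose k)) *
            Real.exp (ballExponent α η * Real.log (N.choose k)) ^ n) ^ p *
          Real.exp (-((n + 1) * γ ^ 2 * p * Real.log (N.choose k) / (1 + n * ν₂ ^ p)))) := by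
          rw [Real.exp_log hC]
          gcongr
      _ = Real.exp (Real.log (N.choose k) * (δ / (4 * (n + 1)) * (n + 1) +
            p * (1 + n * ballExponent α η) - (n + 1) * γ ^ 2 * p / (1 + n * ν₂ ^ p))) := by
          simp only [← Real.exp_nat_mul, ← Real.exp_add]
          congr 1
          push_cast
          ring
      _ ≤ _ := by
          gcongr
          exact unionBound_exponent_le hp1 hδ (by rw [hδdef]; ring) hηε (by positivity)
            (hP p ((le_max_left _ _).trans hp)) rfl
  have huniv := measureReal_union_le (μ := μ)
    {ω | overlapSet k γ (1 - η) ν₂ (J : Set ℝ) (fun ℓ x => A ℓ x ω) = ∅}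
    {ω | overlapSet k γ (1 - η) ν₂ (J : Set ℝ) (fun ℓ x => A ℓ x ω) = ∅}ᶜ
  rw [Set.union_compl_self, probReal_univ] at huniv
  linarith
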